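/- Let $M$ be a model of Quine's New Foundations NF, i.e. a nonempty structure $(M,\in)$ satisfying extensionality and comprehension for all stratifiable formulae. A set $x$ of $M$ is *strongly cantorian* if the graph of the singleton map $y\mapsto\{y\}$ restricted to $x$ is a set of $M$. Assume that $M$ satisfies the axiom SCU: the sumset of a strongly cantorian set of strongly cantorian sets is strongly cantorian. Let $\mathbf N$ be the category whose objects are the sets of $M$ and whose morphisms are the functions between them whose graphs are sets of $M$. Call a morphism of $\mathbf N$ *small* if all of its fibres are strongly cantorian, and call a monomorphism $R\rightarrowtail C\times X$ a *small relation* if its composite with the projection to $X$ is small. A *powerclass* of an object $C$ is an object $\mathbf PC$ together with a small relation $\epsilon_C\rightarrowtail C\times\mathbf PC$ such that 1. for every object $X$ and every small relation $R\rightarrowtail C\times X$ there is a unique morphism $\rho:X\to\mathbf PC$ for which there is a pullback square $$\begin{array}{ccc} R & \longrightarrow & \epsilon_C\\ \downarrow & & \downarrow\\ C\times X & \xrightarrow{\;1_C\times\rho\;} & C\times\mathbf PC\end{array}$$ 2. the internal subset relation $\subset_C\;\rightarrowtail\mathbf PC\times\mathbf PC$ (the subobject defined in the internal language by $\forall c\,(c\mathrel{\epsilon}p\Rightarrow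 c\mathrel{\epsilon}q)$) is a small relation. **Proposition.** It is not the case that every object of $\mathbf N$ has a powerclass. In particular, there is no powerclass functor $\mathbf P:\mathbf N\to\mathbf N$. -/

import Mathlib

open CategoryTheory CategoryTheory.Limits

universe u v w

/-- Formulae of the first-order language of set theory, with variables named by natural numbers. -/
inductive SetFormula : Type
  | eq (i j : ℕ) : SetFormula
  | mem (i j : ℕ) : SetFormula
  | neg (φ : SetFormula) : SetFormula
  | and (φ ψ : SetFormula) : SetFormula
  | or (φ ψ : SetFormula) : SetFormula
  | imp (φ ψ : SetFormula) : SetFormula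
  | all (i : ℕ) (φ : SetFormula) : SetFormula
  | ex (i : ℕ) (φ : SetFormula) : SetFormula

namespace SetFormula

/-- Truth of a formula in the structure `(M, E)` under the assignment `s` of its variables. -/
def Sat {M : Type u} (E : M → M → Prop) : SetFormula → (ℕ → M) → Prop
  | eq i j, s => s i = s j
  | mem i j, s => E (s i) (s j)
  | neg φ, s => ¬ Sat E φ s
  | and φ ψ, s => Sat E φ s ∧ Sat E ψ s
  | or φ ψ, s => Sat E φ s ∨ Sat E ψ s
  | imp φ ψ, s => Sat E φ s → Sat E ψ s
  | all i φ, s => ∀ x, Sat E φ (Function.update s i x)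
  | ex i φ, s => ∃ x, Sat E φ (Function.update s i x)

/-- `σ` is a stratification of the formula: variables joined by `=` get the same type, and
`σ i + 1 = σ j` whenever `i ∈ j` occurs.  All occurrences of a variable, free or bound, get the
same type because `σ` is a function of the variable. -/
def IsStratification (σ : ℕ → ℕ) : SetFormula → Prop
  | eq i j => σ i = σ j
  | mem i j => σ i + 1 = σ j
  | neg φ => IsStratification σ φ
  | and φ ψ => IsStratification σ φ ∧ IsStratification σ ψ
  | or φ ψ => IsStratification σ φ ∧ IsStratification σ ψ
  | imp φ ψ => IsStratification σ φ ∧ IsStratification σ ψ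
  | all _ φ => IsStratification σ φ
  | ex _ φ => IsStratification σ φ

/-- A formula is stratifiable if it has a stratification. -/
def Stratifiable (φ : SetFormula) : Prop := ∃ σ : ℕ → ℕ, φ.IsStratification σ

end SetFormula

/-- A model of Quine's New Foundations: a nonempty structure `(M, mem)` that satisfies
extensionality and every instance of comprehension for a stratifiable formula (the variable `i`
ranges over the candidate members; the assignment `s` supplies the parameters). -/
class NFModel (M : Type u) where
  mem : M → M → Prop
  nonempty : Nonempty M
  extensionality : ∀ x y : M, (∀ z, mem z x ↔ mem z y) → x = y
  comprehension : ∀ φ : SetFormula, φ.Stratifiable → ∀ (i : ℕ) (s : ℕ → M),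
    ∃ y, ∀ z, mem z y ↔ φ.Sat mem (Function.update s i z)

namespace NF

variable {M : Type u} [NFModel M]

/-- The membership relation of the model. -/
scoped infix:50 " ∈' " => NFModel.mem

open SetFormula

theorem exists_upair (x y : M) : ∃ p : M, ∀ z, z ∈' p ↔ z = x ∨ z = y := by
  obtain ⟨p, hp⟩ := NFModel.comprehension (M := M) (or (eq 0 1) (eq 0 2))
    ⟨fun _ => 0, by simp [IsStratification]⟩ 0 (fun n => if n = 1 then x else y)
  exact ⟨p, fun z => by simpa [Sat] using hp z⟩

/-- The unordered pair `{x, y}`. -/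
noncomputable def upair (x y : M) : M := (exists_upair x y).choose

theorem mem_upair (x y z : M) : z ∈' upair x y ↔ z = x ∨ z = y :=
  (exists_upair x y).choose_spec z

/-- The singleton `ι(x) = {x}`. -/
noncomputable def single (x : M) : M := upair x x

theorem mem_single (x z : M) : z ∈' single x ↔ z = x := by simp [single, mem_upair]

/-- The (Wiener-Kuratowski) ordered pair `{{x}, {x, y}}`, in which `x` and `y` have equal type. -/
noncomputable def pair (x y : M) : M := upair (single x) (upair x y)

theorem pair_inj {x y x' y' : M} : pair x y = pair x' y' ↔ x = x' ∧ y = y' := by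
  refine ⟨fun h => ?_, by rintro ⟨rfl, rfl⟩; rfl⟩
  have key : ∀ z : M, (z = single x ∨ z = upair x y) ↔ (z = single x' ∨ z = upair x' y') :=
    fun z => by rw [← mem_upair, ← mem_upair]; exact iff_of_eq (congrArg _ h)
  have hs : ∀ a b : M, single a = single b → a = b := fun a b e => by
    have := (mem_single a a).2 rfl
    rwa [e, mem_single] at this
  have hsu : ∀ a b c : M, single a = upair b c → a = b ∧ a = c := fun a b c e => by
    have h1 := (mem_upair b c b).2 (Or.inl rfl)
    have h2 := (mem_upair b c c).2 (Or.inr rfl)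
    rw [← e, mem_single] at h1 h2
    exact ⟨h1.symm, h2.symm⟩
  have hx : x = x' := by
    rcases (key (single x)).1 (Or.inl rfl) with e | e
    · exact hs _ _ e
    · exact (hsu _ _ _ e).1
  subst hx
  refine ⟨rfl, ?_⟩
  have hu : ∀ b c : M, upair x b = upair x c → b = x ∨ b = c := fun b c e => by
    have h1 := (mem_upair x b b).2 (Or.inr rfl)
    rwa [e, mem_upair] at h1
  rcases (key (upair x y)).1 (Or.inr rfl) with e | e
  · have hy := (hsu _ _ _ e.symm).2
    subst hy
    rcases (key (upair x y')).2 (Or.inr rfl) with e' | e'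
    · exact (hsu _ _ _ e'.symm).2
    · rcases hu _ _ e' with h' | h' <;> exact h'.symm
  · rcases hu _ _ e with h' | h'
    · subst h'
      rcases hu _ _ e.symm with h'' | h'' <;> exact h''.symm
    · exact h'

/-- `A` is strongly cantorian: the graph of the singleton function restricted to `A` is a set. -/
def StronglyCantorian (A : M) : Prop :=
  ∃ G : M, ∀ p, p ∈' G ↔ ∃ x, x ∈' A ∧ p = pair x (single x)

variable (M) in
/-- The axiom SCU: the sumset of a strongly cantorian set of strongly cantorian sets is strongly
cantorian. -/
def SCU : Prop :=
  ∀ X U : M, StronglyCantorian X → (∀ x, x ∈' X → StronglyCantorian x) →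
    (∀ z, z ∈' U ↔ ∃ x, x ∈' X ∧ z ∈' x) → StronglyCantorian U

variable (M) in
/-- The objects of the category of sets of the model: all its sets. -/
structure NFCat : Type u where
  set : M

/-- The elements of a set of the model. -/
def El (A : NFCat M) : Type u := {x : M // x ∈' A.set}

/-- `G` is the graph of `f`. -/
def IsGraph {A B : NFCat M} (f : El A → El B) (G : M) : Prop :=
  ∀ p, p ∈' G ↔ ∃ x : El A, p = pair x.1 (f x).1

/-- Morphisms: the functions whose graph is a set of the model. -/
@[ext]
structure Hom (A B : NFCat M) : Type u where
  toFun : El A → El B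
  isSet : ∃ G : M, IsGraph toFun G

/-- The formula "the variable `p` is the unordered pair of the variables `x` and `y`", with `t`
as bound variable. -/
def upairF (x y p t : ℕ) : SetFormula :=
  all t (and (imp (mem t p) (or (eq t x) (eq t y))) (imp (or (eq t x) (eq t y)) (mem t p)))

theorem eq_upair_iff (p x y : M) : p = upair x y ↔
    ∀ z, (z ∈' p → z = x ∨ z = y) ∧ (z = x ∨ z = y → z ∈' p) := by
  constructor
  · rintro rfl z
    exact ⟨(mem_upair x y z).1, (mem_upair x y z).2⟩
  · intro h
    exact NFModel.extensionality _ _ fun z => by rw [mem_upair]; exact ⟨(h z).1, (h z).2⟩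

/-- The formula "the variable `p` is the ordered pair of the variables `x` and `y`", with bound
variables `1, 5, 12`. -/
def pairF (x y p : ℕ) : SetFormula :=
  ex 1 (ex 5 (and (upairF x x 1 12) (and (upairF x y 5 12) (upairF 1 5 p 9))))

theorem sat_upairF (x y p t : ℕ) (s : ℕ → M) (hx : x ≠ t) (hy : y ≠ t) (hp : p ≠ t) :
    (upairF x y p t).Sat NFModel.mem s ↔ s p = upair (s x) (s y) := by
  rw [eq_upair_iff]
  simp [upairF, Sat, Function.update_of_ne, hx, hy, hp]

theorem sat_pairF (x y p : ℕ) (s : ℕ → M) (hx : x ≠ 1 ∧ x ≠ 5 ∧ x ≠ 12)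
    (hy : y ≠ 1 ∧ y ≠ 5 ∧ y ≠ 12) (hp : p ≠ 1 ∧ p ≠ 5 ∧ p ≠ 9) :
    (pairF x y p).Sat NFModel.mem s ↔ s p = pair (s x) (s y) := by
  obtain ⟨hx1, hx5, hx12⟩ := hx
  obtain ⟨hy1, hy5, hy12⟩ := hy
  obtain ⟨hp1, hp5, hp9⟩ := hp
  simp only [pairF, Sat]
  rw [exists_congr fun a => exists_congr fun b => by
    rw [sat_upairF x x 1 12 _ hx12 hx12 (by decide), sat_upairF x y 5 12 _ hx12 hy12 (by decide),
      sat_upairF 1 5 p 9 _ (by decide) (by decide) hp9]]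
  simp [Function.update_of_ne, hx1, hx5, hy1, hy5, hp1, hp5, pair, single]

theorem id_isSet (A : NFCat M) : ∃ G : M, IsGraph (fun x : El A => x) G := by
  obtain ⟨G, hG⟩ := NFModel.comprehension (M := M)
    (ex 0 (and (mem 0 13) (pairF 0 0 10))) ⟨fun n => n % 4, by simp [IsStratification, pairF, upairF]⟩
    10 (fun _ => A.set)
  refine ⟨G, fun p => (hG p).trans ?_⟩
  simp only [Sat]
  rw [exists_congr fun a => by rw [sat_pairF 0 0 10 _ (by decide) (by decide) (by decide)]]
  simp [Function.update_of_ne, El]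

theorem comp_isSet {A B C : NFCat M} (f : Hom A B) (g : Hom B C) :
    ∃ G : M, IsGraph (fun x => g.toFun (f.toFun x)) G := by
  obtain ⟨F, hF⟩ := f.isSet
  obtain ⟨G, hG⟩ := g.isSet
  obtain ⟨H, hH⟩ := NFModel.comprehension (M := M)
    (ex 0 (ex 4 (ex 8 (ex 2 (ex 6 (and (mem 2 3) (and (pairF 0 4 2) (and (mem 6 7)
      (and (pairF 4 8 6) (pairF 0 8 10))))))))))
    ⟨fun n => n % 4, by simp [IsStratification, pairF, upairF]⟩
    10 (fun n => if n = 3 then F else G)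
  refine ⟨H, fun p => (hH p).trans ?_⟩
  simp only [Sat]
  rw [exists_congr fun a => exists_congr fun b => exists_congr fun c => exists_congr fun d =>
    exists_congr fun e => by
    rw [sat_pairF 0 4 2 _ (by decide) (by decide) (by decide),
      sat_pairF 4 8 6 _ (by decide) (by decide) (by decide),
      sat_pairF 0 8 10 _ (by decide) (by decide) (by decide)]]
  simp only [Function.update_apply]
  norm_num
  constructor
  · rintro ⟨x, y, z, _, h1, rfl, _, h2, rfl, h3⟩
    obtain ⟨a, ha⟩ := (hF _).1 h1
    obtain ⟨b, hb⟩ := (hG _).1 h2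
    rw [pair_inj] at ha hb
    have hab : f.toFun a = b := Subtype.ext (ha.2.symm.trans hb.1)
    exact ⟨a, by rw [h3, ha.1, hb.2, hab]⟩
  · rintro ⟨a, rfl⟩
    exact ⟨_, _, _, _, (hF _).2 ⟨a, rfl⟩, rfl, _, (hG _).2 ⟨f.toFun a, rfl⟩, rfl, rfl⟩

/-- The category of sets of the model. -/
instance : Category.{u} (NFCat M) where
  Hom A B := Hom A B
  id A := ⟨fun x => x, id_isSet A⟩
  comp f g := ⟨fun x => g.toFun (f.toFun x), comp_isSet f g⟩

variable (M) in
/-- The strongly cantorian maps: those all of whose fibres are strongly cantorian. -/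
def stronglyCantorianMaps : MorphismProperty (NFCat M) := fun A B f =>
  ∀ b : El B, ∃ F : M, (∀ z, z ∈' F ↔ ∃ a : El A, a.1 = z ∧ Hom.toFun f a = b) ∧
    StronglyCantorian F

end NF

section AlgebraicSetTheory

variable {𝒞 : Type w} [Category.{v} 𝒞]

/-- For a product cone `q` of `C` and `X`: the morphism `r : R ⟶ C × X` is a small relation, that
is, a monomorphism whose composite with the projection to `X` is a small map. -/
def IsSmallRelation (S : MorphismProperty 𝒞) {C X : 𝒞} (q : BinaryFan C X) {R : 𝒞}
    (r : R ⟶ q.pt) : Prop :=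
  Mono r ∧ S (r ≫ q.snd)

/-- The morphism `⟨a, b⟩ : T ⟶ A × B` into a product cone. -/
def pairing {A B T : 𝒞} {q : BinaryFan A B} (hq : IsLimit q) (a : T ⟶ A) (b : T ⟶ B) : T ⟶ q.pt :=
  hq.lift (BinaryFan.mk a b)

/-- The morphism `1 × ρ : C × X ⟶ C × P` between product cones. -/
def oneTimes {C X P : 𝒞} (q : BinaryFan C X) {p : BinaryFan C P} (hp : IsLimit p) (ρ : X ⟶ P) :
    q.pt ⟶ p.pt :=
  pairing hp q.fst (q.snd ≫ ρ)

/-- `T ⊩ ∀ c : C, c ε a → c ε b` for generalized elements `a b : T ⟶ P` and a relation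
`ε : E ⟶ C × P` (Kripke-Joyal semantics). -/
def InternalSubset {C P E : 𝒞} {p : BinaryFan C P} (hp : IsLimit p) (ε : E ⟶ p.pt) {T : 𝒞}
    (a b : T ⟶ P) : Prop :=
  ∀ (U : 𝒞) (h : U ⟶ T) (c : U ⟶ C),
    (∃ t : U ⟶ E, t ≫ ε = pairing hp c (h ≫ a)) → ∃ t : U ⟶ E, t ≫ ε = pairing hp c (h ≫ b)

/-- A powerclass of `C`, relative to a class `S` of small maps: an object `P` with a small relation
`ε : E ⟶ C × P` such that every small relation `r : R ⟶ C × X` is the pullback of `ε` along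
`1 × ρ` for a unique `ρ : X ⟶ P`, and such that the internal subset relation
`sub : Sub ⟶ P × P` is small.  Products are given by arbitrary product cones. -/
structure Powerclass (S : MorphismProperty 𝒞) (C : 𝒞) where
  P : 𝒞
  prod : BinaryFan C P
  isProd : IsLimit prod
  E : 𝒞
  ε : E ⟶ prod.pt
  small_ε : IsSmallRelation S prod ε
  classify : ∀ (X : 𝒞) (q : BinaryFan C X), IsLimit q → ∀ (R : 𝒞) (r : R ⟶ q.pt),
    IsSmallRelation S q r →
      ∃! ρ : X ⟶ P, ∃ k : R ⟶ E, IsPullback k r ε (oneTimes q isProd ρ)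
  sq : BinaryFan P P
  isSq : IsLimit sq
  Sub : 𝒞
  sub : Sub ⟶ sq.pt
  sub_spec : ∀ (T : 𝒞) (f : T ⟶ sq.pt),
    (∃ g : T ⟶ Sub, g ≫ sub = f) ↔ InternalSubset isProd ε (f ≫ sq.fst) (f ≫ sq.snd)
  small_sub : IsSmallRelation S sq sub

end AlgebraicSetTheory

/-! The universal set `V` has no powerclass. Suppose it had one, `P`. A strongly cantorian set is a
small relation from `V` to the one-point object, so it is the fibre of `ε` over some point of `P`;
conversely the fibres of `ε` are strongly cantorian, because `ε` is small. Being a fibre of `ε` is a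
stratified condition, so the strongly cantorian sets would form a set `𝒮` of the model
(`exists_set_of_powerclass`).

Such an `𝒮` revives the Burali-Forti paradox (`not_exists_set_of_stronglyCantorian`). In NF the
paradox is normally blocked because sending a point of an order to the rank of its initial segment
raises types. An order `R` with strongly cantorian domain is, however, equivalent to its copy `lift
R` on singletons, so types can be shifted freely. With `𝒮` as a parameter, "well-founded order with
strongly cantorian domain" becomes stratified, so the ranks of all such orders form an order
`rankOrder`. It is well-founded, and its domain is again strongly cantorian since `rank (lift R) =
rank R` (`scDom_rankOrder`). Every such order embeds in a proper initial segment of `rankOrder`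
(`IsScOrder.embedsBelow_rankOrder`), hence so does `rankOrder` itself, against well-foundedness
(`IsScOrder.not_embedsBelow`).

Comparability of orders is never needed, so they need not be linear. -/

namespace SetFormula

/-! ### Renaming of variables -/

/-- Renaming of all variables, free and bound. -/
def rename (f : ℕ → ℕ) : SetFormula → SetFormula
  | eq i j => eq (f i) (f j)
  | mem i j => mem (f i) (f j)
  | neg φ => neg (rename f φ)
  | and φ ψ => and (rename f φ) (rename f ψ)
  | or φ ψ => or (rename f φ) (rename f ψ)
  | imp φ ψ => imp (rename f φ) (rename f ψ)
  | all i φ => all (f i) (rename f φ)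
  | ex i φ => ex (f i) (rename f φ)

theorem isStratification_rename (f σ : ℕ → ℕ) (φ : SetFormula) :
    (rename f φ).IsStratification σ ↔ φ.IsStratification (σ ∘ f) := by
  induction φ <;> simp_all [rename, IsStratification]

theorem sat_rename {M : Type u} (E : M → M → Prop) {f : ℕ → ℕ} (hf : f.Injective)
    (φ : SetFormula) (s : ℕ → M) : (rename f φ).Sat E s ↔ φ.Sat E (s ∘ f) := by
  induction φ generalizing s <;>
    simp_all [rename, Sat, Function.update_comp_eq_of_injective]

end SetFormula

namespace NF

open SetFormula

/-! ### Environments (even variables) interleaved with parameters (odd variables) -/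

/-- The sequence `a, s 0, s 1, …`. -/
def seqCons {α : Type*} (a : α) (s : ℕ → α) : ℕ → α
  | 0 => a
  | n + 1 => s n

/-- The sequence `e 0, s 0, e 1, s 1, …`. -/
def interleave {α : Type*} (e s : ℕ → α) (n : ℕ) : α := if n % 2 = 0 then e (n / 2) else s (n / 2)

theorem interleave_comp_rename {α : Type*} (h : ℕ → ℕ) (e s : ℕ → α) :
    (interleave e s ∘ fun n => if n % 2 = 0 then 2 * h (n / 2) else n) =
      interleave (e ∘ h) s := by
  funext n
  by_cases hn : n % 2 = 0 <;> simp [interleave, hn]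

theorem interleave_comp_left {α : Type*} (e s s' : ℕ → α) :
    (interleave e (interleave s s') ∘ fun n => if n % 2 = 0 then n else 2 * n - 1) =
      interleave e s := by
  funext n
  by_cases hn : n % 2 = 0
  · simp [interleave, hn]
  · have h1 : (2 * n - 1) % 2 = 1 := by omega
    have h2 : (2 * n - 1) / 2 % 2 = 0 := by omega
    have h3 : (2 * n - 1) / 2 / 2 = n / 2 := by omega
    simp only [interleave, hn, Function.comp, h1, h2, h3, if_true, if_false, one_ne_zero]

theorem interleave_comp_right {α : Type*} (e s s' : ℕ → α) :
    (interleave e (interleave s s') ∘ fun n => if n % 2 = 0 then n else 2 * n + 1) =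
      interleave e s' := by
  funext n
  by_cases hn : n % 2 = 0
  · simp [interleave, hn]
  · have h1 : (2 * n + 1) % 2 = 1 := by omega
    have h2 : (2 * n + 1) / 2 % 2 = 1 := by omega
    have h3 : (2 * n + 1) / 2 / 2 = n / 2 := by omega
    simp only [interleave, hn, Function.comp, h1, h2, h3, if_false, one_ne_zero]

/-- The injection `0 ↦ 1`, `2 (i + 1) ↦ 2 i`, `2 j + 1 ↦ 2 j + 3`, which makes the first entry of an
environment the first parameter. -/
def headToParam (n : ℕ) : ℕ := if n = 0 then 1 else if n % 2 = 0 then n - 2 else n + 2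

theorem headToParam_injective : Function.Injective headToParam := by
  intro a b hab
  simp only [headToParam] at hab
  split_ifs at hab <;> omega

theorem interleave_comp_headToParam {α : Type*} (a : α) (e s : ℕ → α) :
    interleave e (seqCons a s) ∘ headToParam = interleave (seqCons a e) s := by
  funext n
  rcases Nat.eq_zero_or_pos n with rfl | hn0
  · simp [interleave, headToParam, seqCons]
  obtain ⟨m, rfl | rfl⟩ := Nat.even_or_odd' n
  · obtain ⟨m, rfl⟩ : ∃ k, m = k + 1 := ⟨m - 1, by omega⟩
    have h1 : (2 * (m + 1) - 2) = 2 * m := by omega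
    simp [interleave, headToParam, seqCons, h1]
  · have h1 : (2 * m + 1 + 2) % 2 = 1 := by omega
    have h2 : (2 * m + 1 + 2) / 2 = m + 1 := by omega
    have h3 : (2 * m + 1) / 2 = m := by omega
    simp [interleave, headToParam, seqCons, h1, h2, h3]

theorem update_interleave_one {α : Type*} (a b : α) (e s : ℕ → α) :
    Function.update (interleave e (seqCons a s)) 1 b = interleave e (seqCons b s) := by
  funext n
  rcases eq_or_ne n 1 with rfl | hn
  · simp [interleave, seqCons]
  · rw [Function.update_of_ne hn]
    by_cases h : n % 2 = 0
    · simp [interleave, h]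
    · obtain ⟨m, hm⟩ : ∃ m, n / 2 = m + 1 := ⟨n / 2 - 1, by omega⟩
      simp [interleave, h, hm, seqCons]

/-! ### A calculus of stratified predicates and terms -/

variable {M : Type u} [NFModel M]

/-- The predicate `P` of an environment, whose `i`-th entry has type `τ i`, is given by a stratified
formula with parameters. -/
def Strat (τ : ℕ → ℕ) (P : (ℕ → M) → Prop) : Prop :=
  ∃ (φ : SetFormula) (ρ : ℕ → ℕ) (s : ℕ → M), φ.IsStratification (interleave τ ρ) ∧
    ∀ e, φ.Sat NFModel.mem (interleave e s) ↔ P e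

/-- The function `f` of an environment has a stratified graph, with values of type `k`. -/
def Term (τ : ℕ → ℕ) (k : ℕ) (f : (ℕ → M) → M) : Prop :=
  Strat (seqCons k τ) (fun e => e 0 = f (fun n => e (n + 1)))

variable {τ : ℕ → ℕ} {k : ℕ}

theorem Strat.congr {P Q : (ℕ → M) → Prop} (hP : Strat τ P) (h : ∀ e, P e ↔ Q e) : Strat τ Q := by
  rwa [← funext fun e => propext (h e)]

theorem Strat.rename {P : (ℕ → M) → Prop} (h : ℕ → ℕ) (hh : h.Injective)
    (hP : Strat (τ ∘ h) P) : Strat τ (fun e => P (e ∘ h)) := by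
  obtain ⟨φ, ρ, s, hφ, hs⟩ := hP
  have hf : Function.Injective fun n => if n % 2 = 0 then 2 * h (n / 2) else n := by
    intro a b hab
    simp only at hab
    split_ifs at hab with h1 h2 h2
    · have := @hh (a / 2) (b / 2) (by omega)
      omega
    all_goals omega
  refine ⟨φ.rename fun n => if n % 2 = 0 then 2 * h (n / 2) else n, ρ, s, ?_, fun e => ?_⟩
  · rwa [isStratification_rename, interleave_comp_rename]
  · rw [sat_rename _ hf, interleave_comp_rename, hs]

theorem Strat.not {P : (ℕ → M) → Prop} (hP : Strat τ P) : Strat τ (fun e => ¬ P e) := by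
  obtain ⟨φ, ρ, s, hφ, hs⟩ := hP
  exact ⟨neg φ, ρ, s, hφ, fun e => not_congr (hs e)⟩

/-- The two parameter lists are kept apart by renaming, so a parameter that occurs in both conjuncts
may have a different type in each. -/
theorem Strat.and {P Q : (ℕ → M) → Prop} (hP : Strat τ P) (hQ : Strat τ Q) :
    Strat τ (fun e => P e ∧ Q e) := by
  obtain ⟨φ, ρ, s, hφ, hs⟩ := hP
  obtain ⟨ψ, ρ', s', hψ, hs'⟩ := hQ
  have hf : Function.Injective fun n => if n % 2 = 0 then n else 2 * n - 1 := by
    intro a b hab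
    simp only at hab
    split_ifs at hab <;> omega
  have hg : Function.Injective fun n => if n % 2 = 0 then n else 2 * n + 1 := by
    intro a b hab
    simp only at hab
    split_ifs at hab <;> omega
  refine ⟨(φ.rename fun n => if n % 2 = 0 then n else 2 * n - 1).and
    (ψ.rename fun n => if n % 2 = 0 then n else 2 * n + 1), interleave ρ ρ', interleave s s', ⟨?_, ?_⟩, fun e => ?_⟩
  rotate_left 2
  · rw [Sat, sat_rename _ hf, sat_rename _ hg, interleave_comp_left, interleave_comp_right, hs, hs']
  · rwa [isStratification_rename, interleave_comp_left]
  · rwa [isStratification_rename, interleave_comp_right]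

theorem Strat.ex (t : ℕ) {P : M → (ℕ → M) → Prop}
    (hP : Strat (seqCons t τ) (fun e => P (e 0) (fun n => e (n + 1)))) :
    Strat τ (fun e => ∃ x, P x e) := by
  obtain ⟨φ, ρ, s, hφ, hs⟩ := hP
  -- The bound variable takes over the first parameter slot; the value `s 0` put there is a dummy
  -- that the quantifier overwrites.
  refine ⟨.ex 1 (φ.rename headToParam), seqCons t ρ, seqCons (s 0) s, ?_, fun e => ?_⟩
  · simpa only [IsStratification, isStratification_rename, interleave_comp_headToParam] using hφ
  · refine exists_congr fun x => ?_
    rw [sat_rename _ headToParam_injective, update_interleave_one, interleave_comp_headToParam, hs]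
    rfl

theorem Strat.or {P Q : (ℕ → M) → Prop} (hP : Strat τ P) (hQ : Strat τ Q) :
    Strat τ (fun e => P e ∨ Q e) :=
  (hP.not.and hQ.not).not.congr fun e => by tauto

theorem Strat.imp {P Q : (ℕ → M) → Prop} (hP : Strat τ P) (hQ : Strat τ Q) :
    Strat τ (fun e => P e → Q e) :=
  (hP.not.or hQ).congr fun e => by tauto

theorem Strat.iff {P Q : (ℕ → M) → Prop} (hP : Strat τ P) (hQ : Strat τ Q) :
    Strat τ (fun e => P e ↔ Q e) :=
  ((hP.imp hQ).and (hQ.imp hP)).congr fun e => by tauto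

theorem Strat.all (t : ℕ) {P : M → (ℕ → M) → Prop}
    (hP : Strat (seqCons t τ) (fun e => P (e 0) (fun n => e (n + 1)))) :
    Strat τ (fun e => ∀ x, P x e) :=
  (Strat.ex t (P := fun x e => ¬ P x e) hP.not).not.congr fun e => by simp

theorem Strat.wk {t : ℕ} {P : (ℕ → M) → Prop} (hP : Strat τ P) :
    Strat (seqCons t τ) (fun e => P (fun n => e (n + 1))) :=
  Strat.rename (τ := seqCons t τ) Nat.succ Nat.succ_injective hP

theorem Strat.wk_snd {t : ℕ} (P : M → (ℕ → M) → Prop)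
    (hP : Strat (seqCons k τ) (fun e => P (e 0) (fun n => e (n + 1)))) :
    Strat (seqCons k (seqCons t τ)) (fun e => P (e 0) (fun n => e (n + 2))) := by
  have hh : Function.Injective fun n : ℕ => if n = 0 then 0 else n + 1 := by
    intro a b hab
    simp only at hab
    split_ifs at hab <;> omega
  refine Strat.rename (τ := seqCons k (seqCons t τ))
    (P := fun e => P (e 0) (fun n => e (n + 1))) _ hh ?_
  convert hP using 1
  funext n
  cases n <;> rfl

theorem strat_eq_var (i j : ℕ) (h : τ i = τ j) : Strat τ (fun e : ℕ → M => e i = e j) := by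
  obtain ⟨x⟩ := NFModel.nonempty (M := M)
  refine ⟨.eq (2 * i) (2 * j), fun _ => 0, fun _ => x, ?_, fun e => ?_⟩ <;>
    simp [IsStratification, Sat, interleave, h]

theorem strat_mem_var (i j : ℕ) (h : τ i + 1 = τ j) :
    Strat τ (fun e : ℕ → M => e i ∈' e j) := by
  obtain ⟨x⟩ := NFModel.nonempty (M := M)
  refine ⟨.mem (2 * i) (2 * j), fun _ => 0, fun _ => x, ?_, fun e => ?_⟩ <;>
    simp [IsStratification, Sat, interleave, h]

namespace Term

theorem var (i : ℕ) (h : τ i = k := by rfl) : Term τ k (fun e : ℕ → M => e i) :=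
  strat_eq_var 0 (i + 1) h.symm

/-- A parameter is available at every type `k`, and each occurrence chooses its own. -/
theorem const (c : M) : Term τ k (fun _ => c) := by
  refine ⟨.eq 0 1, fun _ => k, fun _ => c, ?_, fun e => ?_⟩ <;>
    simp [IsStratification, Sat, interleave, seqCons]

theorem wk {t : ℕ} {f : (ℕ → M) → M} (hf : Term τ k f) :
    Term (seqCons t τ) k (fun e => f (fun n => e (n + 1))) :=
  Strat.wk_snd (fun x e => x = f e) hf

theorem bind {f : (ℕ → M) → M} (hf : Term τ k f) {P : M → (ℕ → M) → Prop}
    (hP : Strat (seqCons k τ) (fun e => P (e 0) (fun n => e (n + 1)))) :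
    Strat τ (fun e => P (f e) e) :=
  (Strat.ex k (P := fun x e => x = f e ∧ P x e) (Strat.and hf hP)).congr fun e => by simp

end Term

theorem Strat.eq {f g : (ℕ → M) → M} (hf : Term τ k f) (hg : Term τ k g) :
    Strat τ (fun e => f e = g e) :=
  hf.bind (P := fun x e => x = g e) hg

theorem Strat.mem {f g : (ℕ → M) → M} (hf : Term τ k f) (hg : Term τ (k + 1) g) :
    Strat τ (fun e => f e ∈' g e) :=
  hf.bind (P := fun x e => x ∈' g e) <| hg.wk.bind (P := fun y e => e 0 ∈' y) <|
    strat_mem_var 1 0 rfl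

/-! ### Comprehension for stratified predicates -/

/-- The set of the `x` with `P x`, if there is one. -/
noncomputable def sep (P : M → Prop) : M :=
  have := NFModel.nonempty (M := M)
  Classical.epsilon fun y => ∀ x, x ∈' y ↔ P x

theorem mem_sep_of_strat {P : M → (ℕ → M) → Prop} {t : ℕ}
    (hP : Strat (seqCons t τ) (fun e => P (e 0) (fun n => e (n + 1)))) (e : ℕ → M) {x : M} :
    x ∈' sep (fun x => P x e) ↔ P x e := by
  have : ∃ y, ∀ x, x ∈' y ↔ P x e := by
    obtain ⟨φ, ρ, s, hφ, hs⟩ := hP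
    obtain ⟨y, hy⟩ := NFModel.comprehension (M := M) φ ⟨_, hφ⟩ 0 (interleave (seqCons x e) s)
    refine ⟨y, fun z => (hy z).trans ?_⟩
    have : Function.update (interleave (seqCons x e) s) 0 z = interleave (seqCons z e) s := by
      funext n
      rcases eq_or_ne n 0 with rfl | hn
      · simp [interleave, seqCons]
      · rw [Function.update_of_ne hn]
        by_cases h : n % 2 = 0
        · obtain ⟨m, hm⟩ : ∃ m, n / 2 = m + 1 := ⟨n / 2 - 1, by omega⟩
          simp [interleave, h, hm, seqCons]
        · simp [interleave, h]
    rw [this, hs]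
    rfl
  exact Classical.epsilon_spec this x

theorem mem_sep {P : M → Prop} (t : ℕ) (hP : Strat (seqCons t fun _ => 0) (fun e => P (e 0)))
    {x : M} : x ∈' sep P ↔ P x :=
  mem_sep_of_strat (P := fun x _ => P x) hP (fun _ => x)

namespace Term

/-- By extensionality, `y = f e` says that `y` has the members prescribed by `P`. -/
theorem of_mem {f : (ℕ → M) → M} {P : M → (ℕ → M) → Prop}
    (hP : Strat (seqCons k τ) (fun e => P (e 0) (fun n => e (n + 1))))
    (h : ∀ e x, x ∈' f e ↔ P x e) : Term τ (k + 1) f := by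
  have : Strat (seqCons (k + 1) τ) fun e : ℕ → M =>
      ∀ x, x ∈' e 0 ↔ P x (fun n => e (n + 1)) :=
     Strat.all k (.iff (strat_mem_var 0 1 rfl) (Strat.wk_snd P hP))
  refine this.congr fun e => ⟨fun H => NFModel.extensionality _ _ fun x => ?_, fun H x => ?_⟩
  · rw [H, h]
  · rw [H, h]

theorem sep {P : M → (ℕ → M) → Prop}
    (hP : Strat (seqCons k τ) (fun e => P (e 0) (fun n => e (n + 1)))) :
    Term τ (k + 1) (fun e => sep (fun x => P x e)) :=
  of_mem hP fun e _ => mem_sep_of_strat hP e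

theorem upair {f g : (ℕ → M) → M} (hf : Term τ k f) (hg : Term τ k g) :
    Term τ (k + 1) (fun e => upair (f e) (g e)) :=
  of_mem (P := fun x e => x = f e ∨ x = g e) (.or hf hg) fun _ _ => mem_upair _ _ _

theorem single {f : (ℕ → M) → M} (hf : Term τ k f) : Term τ (k + 1) (fun e => single (f e)) :=
  hf.upair hf

theorem pair {f g : (ℕ → M) → M} (hf : Term τ k f) (hg : Term τ k g) :
    Term τ (k + 2) (fun e => pair (f e) (g e)) :=
  hf.single.upair (hf.upair hg)

end Term

/-! ### Stratified graphs and strongly cantorian sets -/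

theorem single_inj {a b : M} : single a = single b ↔ a = b := by
  refine ⟨fun h => ?_, fun h => h ▸ rfl⟩
  have := (mem_single a a).2 rfl
  rwa [h, mem_single] at this

theorem exists_graph (k : ℕ) {Q : M → M → Prop}
    (hQ : ∀ τ, Strat (seqCons k (seqCons k τ)) (fun e => Q (e 0) (e 1))) :
    ∃ f : M, ∀ z, z ∈' f ↔ ∃ b a, z = pair a b ∧ Q a b :=
  ⟨_, fun _ => mem_sep (k + 2) <| .ex k <| .ex k <|
    .and (.eq (.var 2) (.pair (.var 0) (.var 1))) (hQ _)⟩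

theorem exists_rel (k : ℕ) {Q : M → M → Prop}
    (hQ : ∀ τ, Strat (seqCons k (seqCons k τ)) (fun e => Q (e 0) (e 1))) :
    ∃ f : M, ∀ a b, pair a b ∈' f ↔ Q a b := by
  obtain ⟨f, hf⟩ := exists_graph k hQ
  refine ⟨f, fun a b => (hf _).trans ⟨?_, fun h => ⟨b, a, rfl, h⟩⟩⟩
  rintro ⟨b', a', h, hQ⟩
  obtain ⟨rfl, rfl⟩ := pair_inj.1 h
  exact hQ

theorem StronglyCantorian.exists_single {A : M} (hA : StronglyCantorian A) :
    ∃ G : M, ∀ a b, pair a b ∈' G ↔ a ∈' A ∧ b = single a := by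
  obtain ⟨G, hG⟩ := hA
  refine ⟨G, fun a b => (hG _).trans ⟨?_, fun h => ⟨a, h.1, h.2 ▸ rfl⟩⟩⟩
  rintro ⟨x, hx, h⟩
  obtain ⟨rfl, rfl⟩ := pair_inj.1 h
  exact ⟨hx, rfl⟩

/-- The condition `b = single a` puts `b` one type above `a`, while a graph needs them at equal
type; the task is to find an equivalent `Q` that is stratified. -/
theorem stronglyCantorian_of_graph {A : M} (k : ℕ) {Q : M → M → Prop}
    (hQ : ∀ τ, Strat (seqCons k (seqCons k τ)) (fun e => Q (e 0) (e 1)))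
    (h : ∀ a b, Q a b ↔ a ∈' A ∧ b = single a) : StronglyCantorian A := by
  obtain ⟨G, hG⟩ := exists_graph k hQ
  refine ⟨G, fun p => (hG p).trans ?_⟩
  simp only [h]
  constructor
  · rintro ⟨b, a, rfl, ha, rfl⟩
    exact ⟨a, ha, rfl⟩
  · rintro ⟨a, ha, rfl⟩
    exact ⟨_, a, rfl, ha, rfl⟩

theorem StronglyCantorian.subset {A B : M} (hA : StronglyCantorian A)
    (h : ∀ x, x ∈' B → x ∈' A) : StronglyCantorian B := by
  obtain ⟨G, hG⟩ := hA.exists_single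
  refine stronglyCantorian_of_graph 0 (Q := fun a b => a ∈' B ∧ pair a b ∈' G)
    (fun τ => .and (.mem (.var 0) (.const _)) (.mem (.pair (.var 0) (.var 1)) (.const _)))
    fun a b => ?_
  rw [hG]
  exact ⟨fun H => ⟨H.1, H.2.2⟩, fun H => ⟨H.1, h _ H.1, H.2⟩⟩

/-- The singleton map on `B` is obtained by going back along `f` to `x`, to `{x}` by the graph `G`,
down to its element, and along `f` again. The parameter `f` is used at two different types. -/
theorem StronglyCantorian.image {A B f : M} (hA : StronglyCantorian A)
    (hB : ∀ y, y ∈' B ↔ ∃ x, x ∈' A ∧ pair x y ∈' f)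
    (hf : ∀ x y y', pair x y ∈' f → pair x y' ∈' f → y = y') : StronglyCantorian B := by
  obtain ⟨G, hG⟩ := hA.exists_single
  refine stronglyCantorian_of_graph 1
    (Q := fun a b => ∃ x u x' y', pair x u ∈' G ∧ u = single x' ∧ pair x a ∈' f ∧
      pair x' y' ∈' f ∧ b = single y')
    (fun τ => .ex 1 <| .ex 1 <| .ex 0 <| .ex 0 <|
      .and (.mem (.pair (.var 3) (.var 2)) (.const _)) <|
      .and (.eq (.var 2) (.single (.var 1))) <|
      .and (.mem (.pair (.var 3) (.var 4)) (.const _)) <|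
      .and (.mem (.pair (.var 1) (.var 0)) (.const _)) <|
      .eq (.var 5) (.single (.var 0))) fun a b => ?_
  constructor
  · rintro ⟨x, u, x', y', h1, rfl, h2, h3, rfl⟩
    rw [hG, single_inj] at h1
    obtain ⟨hx, rfl⟩ := h1
    obtain rfl := hf _ _ _ h2 h3
    exact ⟨(hB _).2 ⟨_, hx, h2⟩, rfl⟩
  · rintro ⟨ha, rfl⟩
    obtain ⟨x, hx, hxa⟩ := (hB _).1 ha
    exact ⟨x, _, x, a, (hG _ _).2 ⟨hx, rfl⟩, rfl, hxa, hxa, rfl⟩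

/-! ### Orders with strongly cantorian domain and monotone relations -/

/-- `a` belongs to the domain of the order coded by `R`. -/
def Dom (R a : M) : Prop := pair a a ∈' R

/-- `a` is strictly below `b` in the order coded by `R`. -/
def Below (R a b : M) : Prop := Dom R a ∧ Dom R b ∧ a ≠ b ∧ pair a b ∈' R

/-- `f` is a total, possibly multivalued, strictly monotone relation from `R` to `S`. -/
def IsMonotone (f R S : M) : Prop :=
  (∀ a, Dom R a → ∃ b, pair a b ∈' f) ∧ (∀ a b, pair a b ∈' f → Dom S b) ∧
    ∀ a b a' b', pair a b ∈' f → pair a' b' ∈' f → Below R a a' → Below S b b'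

/-- There is a strictly monotone relation from `R` to `S`. -/
def Embeds (R S : M) : Prop := ∃ f, IsMonotone f R S

/-- There is a strictly monotone relation from `R` to a proper initial segment of `S`. -/
def EmbedsBelow (R S : M) : Prop :=
  ∃ f c, IsMonotone f R S ∧ Dom S c ∧ ∀ a b, pair a b ∈' f → Below S b c

/-- `R` codes a transitive well-founded order with strongly cantorian domain. -/
def IsScOrder (R : M) : Prop :=
  (∃ A, StronglyCantorian A ∧ ∀ a, a ∈' A ↔ Dom R a) ∧
  (∀ a b c, Below R a b → Below R b c → Below R a c) ∧
  ∀ Y a, a ∈' Y → Dom R a → ∃ b, b ∈' Y ∧ Dom R b ∧ ∀ c, c ∈' Y → ¬ Below R c b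

theorem Strat.dom {R a : (ℕ → M) → M} (hR : Term τ (k + 3) R) (ha : Term τ k a) :
    Strat τ (fun e => Dom (R e) (a e)) :=
  .mem (.pair ha ha) hR

theorem Strat.below {R a b : (ℕ → M) → M} (hR : Term τ (k + 3) R) (ha : Term τ k a)
    (hb : Term τ k b) : Strat τ (fun e => Below (R e) (a e) (b e)) :=
  .and (.dom hR ha) <| .and (.dom hR hb) <| .and (.not (.eq ha hb)) (.mem (.pair ha hb) hR)

theorem Strat.isMonotone {f R S : (ℕ → M) → M} (hf : Term τ (k + 3) f) (hR : Term τ (k + 3) R)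
    (hS : Term τ (k + 3) S) : Strat τ (fun e => IsMonotone (f e) (R e) (S e)) :=
  .and (.all k <| .imp (.dom hR.wk (.var 0)) <| .ex k <| .mem (.pair (.var 1) (.var 0)) hf.wk.wk) <|
  .and (.all k <| .all k <| .imp (.mem (.pair (.var 1) (.var 0)) hf.wk.wk)
    (.dom hS.wk.wk (.var 0))) <|
  .all k <| .all k <| .all k <| .all k <|
    .imp (.mem (.pair (.var 3) (.var 2)) hf.wk.wk.wk.wk) <|
    .imp (.mem (.pair (.var 1) (.var 0)) hf.wk.wk.wk.wk) <|
    .imp (.below hR.wk.wk.wk.wk (.var 3) (.var 1)) (.below hS.wk.wk.wk.wk (.var 2) (.var 0))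

theorem Strat.embeds {R S : (ℕ → M) → M} (hR : Term τ (k + 3) R) (hS : Term τ (k + 3) S) :
    Strat τ (fun e => Embeds (R e) (S e)) :=
  .ex (k + 3) <| .isMonotone (k := k) (.var 0) hR.wk hS.wk

theorem Strat.embedsBelow {R S : (ℕ → M) → M} (hR : Term τ (k + 3) R) (hS : Term τ (k + 3) S) :
    Strat τ (fun e => EmbedsBelow (R e) (S e)) :=
  .ex (k + 3) <| .ex k <| .and (.isMonotone (k := k) (.var 1) hR.wk.wk hS.wk.wk) <|
    .and (.dom hS.wk.wk (.var 0)) <| .all k <| .all k <|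
    .imp (.mem (.pair (.var 1) (.var 0)) (.var 3)) (.below hS.wk.wk.wk.wk (.var 0) (.var 2))

/-- The set `𝒮` replaces the unstratified notion "strongly cantorian" by membership in a parameter.
-/
theorem Strat.isScOrder {𝒮 : M} (h𝒮 : ∀ A, A ∈' 𝒮 ↔ StronglyCantorian A) {R : (ℕ → M) → M}
    (hR : Term τ (k + 3) R) : Strat τ (fun e => IsScOrder (R e)) := by
  simp only [IsScOrder, ← h𝒮]
  exact .and (.ex (k + 1) <| .and (.mem (.var 0) (.const _)) <| .all k <|
      .iff (.mem (.var 0) (.var 1)) (.dom hR.wk.wk (.var 0))) <|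
    .and (.all k <| .all k <| .all k <| .imp (.below hR.wk.wk.wk (.var 2) (.var 1)) <|
      .imp (.below hR.wk.wk.wk (.var 1) (.var 0)) (.below hR.wk.wk.wk (.var 2) (.var 0))) <|
    .all (k + 1) <| .all k <| .imp (.mem (.var 0) (.var 1)) <| .imp (.dom hR.wk.wk (.var 0)) <|
    .ex k <| .and (.mem (.var 0) (.var 2)) <| .and (.dom hR.wk.wk.wk (.var 0)) <| .all k <|
    .imp (.mem (.var 0) (.var 3)) <| .not (.below hR.wk.wk.wk.wk (.var 0) (.var 1))

theorem IsMonotone.exists_comp {f g R S T : M} (hf : IsMonotone f R S) (hg : IsMonotone g S T) :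
    ∃ h, IsMonotone h R T ∧ ∀ a c, pair a c ∈' h ↔ ∃ b, pair a b ∈' f ∧ pair b c ∈' g := by
  obtain ⟨h, hh⟩ := exists_rel 0 (Q := fun a c => ∃ b, pair a b ∈' f ∧ pair b c ∈' g) fun τ =>
    .ex 0 <| .and (.mem (.pair (.var 1) (.var 0)) (.const f))
      (.mem (.pair (.var 0) (.var 2)) (.const g))
  refine ⟨h, ⟨fun a ha => ?_, fun a c hac => ?_, fun a c a' c' hac hac' haa' => ?_⟩, hh⟩
  · obtain ⟨b, hb⟩ := hf.1 a ha
    obtain ⟨c, hc⟩ := hg.1 b (hf.2.1 _ _ hb)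
    exact ⟨c, (hh _ _).2 ⟨b, hb, hc⟩⟩
  · obtain ⟨b, -, hbc⟩ := (hh _ _).1 hac
    exact hg.2.1 _ _ hbc
  · obtain ⟨b, hab, hbc⟩ := (hh _ _).1 hac
    obtain ⟨b', hab', hbc'⟩ := (hh _ _).1 hac'
    exact hg.2.2 _ _ _ _ hbc hbc' (hf.2.2 _ _ _ _ hab hab' haa')

theorem exists_id (R : M) : ∃ f : M, ∀ a b, pair a b ∈' f ↔ a = b ∧ Dom R a :=
  exists_rel 0 fun _ => .and (.eq (.var 0) (.var 1)) (.dom (k := 0) (.const _) (.var 0))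

theorem Embeds.refl (R : M) : Embeds R R := by
  obtain ⟨f, hf⟩ := exists_id R
  refine ⟨f, fun a ha => ⟨a, (hf _ _).2 ⟨rfl, ha⟩⟩, fun a b hab => ?_, fun a b a' b' h h' H => ?_⟩
  · obtain ⟨rfl, ha⟩ := (hf _ _).1 hab
    exact ha
  · obtain ⟨rfl, ha⟩ := (hf _ _).1 h
    obtain ⟨rfl, ha⟩ := (hf _ _).1 h'
    exact H

theorem Embeds.trans {R S T : M} : Embeds R S → Embeds S T → Embeds R T := by
  rintro ⟨f, hf⟩ ⟨g, hg⟩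
  obtain ⟨h, hh, -⟩ := hf.exists_comp hg
  exact ⟨h, hh⟩

theorem EmbedsBelow.embeds {R S : M} : EmbedsBelow R S → Embeds R S := by
  rintro ⟨f, _, hf, -⟩
  exact ⟨f, hf⟩

theorem Embeds.trans_embedsBelow {R S T : M} : Embeds R S → EmbedsBelow S T → EmbedsBelow R T := by
  rintro ⟨f, hf⟩ ⟨g, c, hg, hc, hgc⟩
  obtain ⟨h, hh, H⟩ := hf.exists_comp hg
  refine ⟨h, c, hh, hc, fun a d had => ?_⟩
  obtain ⟨b, -, hbd⟩ := (H _ _).1 had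
  exact hgc _ _ hbd

theorem IsMonotone.exists_comp_bounded {f R S T : M} (hRS : EmbedsBelow R S)
    (hf : IsMonotone f S T) :
    ∃ h b c, pair b c ∈' f ∧ IsMonotone h R T ∧ ∀ a d, pair a d ∈' h → Below T d c := by
  obtain ⟨g, b, hg, hb, hgb⟩ := hRS
  obtain ⟨h, hh, H⟩ := hg.exists_comp hf
  obtain ⟨c, hc⟩ := hf.1 b hb
  refine ⟨h, b, c, hc, hh, fun a d had => ?_⟩
  obtain ⟨b', hab', hbd'⟩ := (H _ _).1 had
  exact hf.2.2 _ _ _ _ hbd' hc (hgb _ _ hab')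

theorem EmbedsBelow.trans_embeds {R S T : M} (hRS : EmbedsBelow R S) (hST : Embeds S T) :
    EmbedsBelow R T := by
  obtain ⟨f, hf⟩ := hST
  obtain ⟨h, b, c, hbc, hh, hhc⟩ := hf.exists_comp_bounded hRS
  exact ⟨h, c, hh, hf.2.1 _ _ hbc, hhc⟩

theorem EmbedsBelow.trans {R S T : M} (hRS : EmbedsBelow R S) (hST : EmbedsBelow S T) :
    EmbedsBelow R T :=
  hRS.trans_embeds hST.embeds

/-- The bound `c` is moved strictly down by `f`. A minimal point moved down has a value that, by
monotonicity, is moved down too. -/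
theorem IsScOrder.not_embedsBelow {R : M} (hR : IsScOrder R) : ¬ EmbedsBelow R R := by
  rintro ⟨f, c, hf, hc, hfc⟩
  have hY : ∀ x, x ∈' sep (fun a => ∃ b, pair a b ∈' f ∧ Below R b a) ↔
      ∃ b, pair x b ∈' f ∧ Below R b x := fun x =>
    mem_sep 0 <| .ex 0 <| .and (.mem (.pair (.var 1) (.var 0)) (.const _))
      (.below (.const _) (.var 0) (.var 1))
  obtain ⟨b, hb⟩ := hf.1 c hc
  obtain ⟨a, ha, -, hmin⟩ := hR.2.2 _ c ((hY c).2 ⟨b, hb, hfc _ _ hb⟩) hc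
  obtain ⟨b, hab, hba⟩ := (hY a).1 ha
  obtain ⟨d, hd⟩ := hf.1 b hba.1
  exact hmin b ((hY b).2 ⟨d, hd, hf.2.2 _ _ _ _ hd hab hba⟩) hba

/-! ### Raising the type of an order by one -/

/-- The copy of `R` on the singletons of the elements of its domain. -/
noncomputable def lift (R : M) : M :=
  sep fun z => ∃ a b, z = pair (single a) (single b) ∧ pair a b ∈' R

theorem strat_lift {R : (ℕ → M) → M} (hR : Term τ (k + 3) R) :
    Strat (seqCons (k + 3) τ) (fun e => ∃ a b, e 0 = pair (single a) (single b) ∧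
      pair a b ∈' R (fun n => e (n + 1))) :=
  .ex k <| .ex k <| .and (.eq (k := k + 3) (.var 2) (.pair (.single (.var 1)) (.single (.var 0))))
    (.mem (.pair (.var 1) (.var 0)) hR.wk.wk.wk)

theorem Term.lift {R : (ℕ → M) → M} (hR : Term τ (k + 3) R) :
    Term τ (k + 4) (fun e => lift (R e)) :=
  .sep (P := fun z e => ∃ a b, z = NF.pair (NF.single a) (NF.single b) ∧ NF.pair a b ∈' R e)
    (strat_lift hR)

theorem pair_mem_lift {R x y : M} :
    pair x y ∈' lift R ↔ ∃ a b, x = single a ∧ y = single b ∧ pair a b ∈' R := by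
  rw [lift, mem_sep 3 (strat_lift (k := 0) (.const R))]
  simp only [pair_inj, and_assoc]

theorem dom_lift {R x : M} : Dom (lift R) x ↔ ∃ a, x = single a ∧ Dom R a := by
  rw [Dom, pair_mem_lift]
  constructor
  · rintro ⟨a, b, rfl, h, hab⟩
    obtain rfl := single_inj.1 h
    exact ⟨a, rfl, hab⟩
  · rintro ⟨a, rfl, ha⟩
    exact ⟨a, a, rfl, rfl, ha⟩

theorem below_lift {R a b : M} : Below (lift R) (single a) (single b) ↔ Below R a b := by
  simp only [Below, dom_lift, pair_mem_lift, single_inj, ne_eq]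
  simp [← and_assoc]

/-- The domain of the order coded by `R` is a strongly cantorian set. -/
def ScDom (R : M) : Prop := ∃ A, StronglyCantorian A ∧ ∀ a, a ∈' A ↔ Dom R a

theorem ScDom.embeds_lift {R : M} (hR : ScDom R) : Embeds R (lift R) := by
  obtain ⟨A, hA, hAR⟩ := hR
  obtain ⟨G, hG⟩ := hA.exists_single
  simp only [hAR] at hG
  refine ⟨G, fun a ha => ⟨_, (hG _ _).2 ⟨ha, rfl⟩⟩, fun a b hab => ?_, fun a b a' b' h h' H => ?_⟩
  · obtain ⟨ha, rfl⟩ := (hG _ _).1 hab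
    exact dom_lift.2 ⟨a, rfl, ha⟩
  · obtain ⟨-, rfl⟩ := (hG _ _).1 h
    obtain ⟨-, rfl⟩ := (hG _ _).1 h'
    exact below_lift.2 H

theorem ScDom.lift_embeds {R : M} (hR : ScDom R) : Embeds (lift R) R := by
  obtain ⟨A, hA, hAR⟩ := hR
  obtain ⟨G, hG⟩ := hA.exists_single
  simp only [hAR] at hG
  obtain ⟨f, hf⟩ := exists_rel 0 (Q := fun b a => pair a b ∈' G) fun τ =>
    .mem (.pair (.var 1) (.var 0)) (.const _)
  simp only [hG] at hf
  refine ⟨f, fun x hx => ?_, fun b a hab => ((hf _ _).1 hab).1, fun b a b' a' h h' H => ?_⟩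
  · obtain ⟨a, rfl, ha⟩ := dom_lift.1 hx
    exact ⟨a, (hf _ _).2 ⟨ha, rfl⟩⟩
  · obtain ⟨-, rfl⟩ := (hf _ _).1 h
    obtain ⟨-, rfl⟩ := (hf _ _).1 h'
    exact below_lift.1 H

theorem ScDom.lift {R : M} (hR : ScDom R) : ScDom (lift R) := by
  obtain ⟨A, hA, hAR⟩ := hR
  obtain ⟨G, hG⟩ := hA.exists_single
  have hB : ∀ x, x ∈' sep (fun x => ∃ a, a ∈' A ∧ pair a x ∈' G) ↔ ∃ a, a ∈' A ∧ pair a x ∈' G :=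
    fun x => mem_sep 0 <| .ex 0 <| .and (.mem (.var 0) (.const _))
      (.mem (.pair (.var 0) (.var 1)) (.const _))
  refine ⟨_, hA.image hB fun x y y' h h' => ?_, fun x => ?_⟩
  · rw [hG] at h h'
    rw [h.2, h'.2]
  · rw [hB, dom_lift]
    simp only [hG, hAR]
    exact exists_congr fun a => ⟨fun h => ⟨h.2.2, h.1⟩, fun h => ⟨h.2, h.2, h.1⟩⟩

/-! ### Initial segments -/

/-- The initial segment of `R` below `c`. -/
noncomputable def segment (R c : M) : M :=
  sep fun z => ∃ a b, z = pair a b ∧ Below R a c ∧ Below R b c ∧ pair a b ∈' R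

theorem strat_segment {R c : (ℕ → M) → M} (hR : Term τ (k + 3) R) (hc : Term τ k c) :
    Strat (seqCons (k + 2) τ) (fun e => ∃ a b, e 0 = pair a b ∧
      Below (R (fun n => e (n + 1))) a (c (fun n => e (n + 1))) ∧
      Below (R (fun n => e (n + 1))) b (c (fun n => e (n + 1))) ∧
      pair a b ∈' R (fun n => e (n + 1))) :=
  .ex k <| .ex k <| .and (.eq (k := k + 2) (.var 2) (.pair (.var 1) (.var 0))) <|
    .and (.below hR.wk.wk.wk (.var 1) hc.wk.wk.wk) <|
    .and (.below hR.wk.wk.wk (.var 0) hc.wk.wk.wk) <|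
    .mem (.pair (.var 1) (.var 0)) hR.wk.wk.wk

theorem Term.segment {R c : (ℕ → M) → M} (hR : Term τ (k + 3) R) (hc : Term τ k c) :
    Term τ (k + 3) (fun e => segment (R e) (c e)) :=
  .sep (P := fun z e => ∃ a b, z = NF.pair a b ∧ Below (R e) a (c e) ∧ Below (R e) b (c e) ∧
    NF.pair a b ∈' R e) (strat_segment hR hc)

theorem pair_mem_segment {R a b c : M} :
    pair a b ∈' segment R c ↔ Below R a c ∧ Below R b c ∧ pair a b ∈' R := by
  rw [segment, mem_sep 2 (strat_segment (k := 0) (.const R) (.const c))]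
  constructor
  · rintro ⟨a', b', h, H⟩
    obtain ⟨rfl, rfl⟩ := pair_inj.1 h
    exact H
  · exact fun H => ⟨a, b, rfl, H⟩

theorem dom_segment {R a c : M} : Dom (segment R c) a ↔ Below R a c := by
  rw [Dom, pair_mem_segment]
  exact ⟨fun h => h.1, fun h => ⟨h, h, h.1⟩⟩

theorem below_segment {R a b c : M} :
    Below (segment R c) a b ↔ Below R a c ∧ Below R b c ∧ Below R a b := by
  simp only [Below, dom_segment, pair_mem_segment]
  tauto

theorem IsScOrder.segment {R : M} (hR : IsScOrder R) (c : M) : IsScOrder (segment R c) := by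
  obtain ⟨⟨A, hA, hAR⟩, htrans, hwf⟩ := hR
  refine ⟨?_, fun x y z hxy hyz => ?_, fun Y a ha haR => ?_⟩
  · have hB : ∀ x, x ∈' sep (fun x => Below R x c) ↔ Below R x c := fun x =>
      mem_sep (P := fun x => Below R x c) 0 <| .below (.const _) (.var 0) (.const _)
    exact ⟨_, hA.subset fun x hx => (hAR _).2 ((hB _).1 hx).1, fun x => (hB x).trans
      dom_segment.symm⟩
  · rw [below_segment] at *
    exact ⟨hxy.1, hyz.2.1, htrans _ _ _ hxy.2.2 hyz.2.2⟩
  · have hY : ∀ x, x ∈' sep (fun x => x ∈' Y ∧ Below R x c) ↔ x ∈' Y ∧ Below R x c := fun x =>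
      mem_sep (P := fun x => x ∈' Y ∧ Below R x c) 0 <|
        .and (.mem (.var 0) (.const _)) (.below (.const _) (.var 0) (.const _))
    rw [dom_segment] at haR
    obtain ⟨b, hb, -, hmin⟩ := hwf _ a ((hY _).2 ⟨ha, haR⟩) haR.1
    rw [hY] at hb
    refine ⟨b, hb.1, dom_segment.2 hb.2, fun d hd hdb => ?_⟩
    rw [below_segment] at hdb
    exact hmin d ((hY _).2 ⟨hd, hdb.1⟩) hdb.2.2

theorem embedsBelow_of_id {R S c : M} (hRS : ∀ a b, Below R a b → Below S a b) (hc : Dom S c)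
    (h : ∀ a, Dom R a → Below S a c) : EmbedsBelow R S := by
  obtain ⟨f, hf⟩ := exists_id R
  refine ⟨f, c, ⟨fun a ha => ⟨a, (hf _ _).2 ⟨rfl, ha⟩⟩, fun a b hab => ?_,
    fun a b a' b' h1 h2 H => ?_⟩, hc, fun a b hab => ?_⟩
  · obtain ⟨rfl, ha⟩ := (hf _ _).1 hab
    exact (h a ha).1
  · obtain ⟨rfl, ha⟩ := (hf _ _).1 h1
    obtain ⟨rfl, ha'⟩ := (hf _ _).1 h2
    exact hRS _ _ H
  · obtain ⟨rfl, ha⟩ := (hf _ _).1 hab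
    exact h a ha

theorem segment_embedsBelow {R c : M} (hc : Dom R c) : EmbedsBelow (segment R c) R :=
  embedsBelow_of_id (fun _ _ h => (below_segment.1 h).2.2) hc fun _ h => dom_segment.1 h

theorem IsScOrder.segment_embedsBelow_segment {R a b : M} (hR : IsScOrder R) (hab : Below R a b) :
    EmbedsBelow (NF.segment R a) (NF.segment R b) := by
  have h : ∀ x, Below R x a → Below R x b := fun x hx => hR.2.1 _ _ _ hx hab
  refine embedsBelow_of_id (fun x y hxy => ?_) (dom_segment.2 hab) fun x hx => ?_
  · rw [below_segment] at *
    exact ⟨h _ hxy.1, h _ hxy.2.1, hxy.2.2⟩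
  · rw [dom_segment] at hx
    exact below_segment.2 ⟨h _ hx, hab, hx⟩

/-! ### Ranks and the Burali-Forti paradox -/

/-- The set of the orders that embed in `R`. -/
noncomputable def rank (R : M) : M := sep fun Z => IsScOrder Z ∧ Embeds Z R

variable (M) in
/-- The order of the ranks of all orders with strongly cantorian domain. -/
noncomputable def rankOrder : M :=
  sep fun z => ∃ R S, z = pair (rank R) (rank S) ∧
    IsScOrder R ∧ IsScOrder S ∧ (rank R = rank S ∨ EmbedsBelow R S)

theorem strat_rank {𝒮 : M} (h𝒮 : ∀ A, A ∈' 𝒮 ↔ StronglyCantorian A) {R : (ℕ → M) → M}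
    (hR : Term τ (k + 3) R) :
    Strat (seqCons (k + 3) τ) (fun e => IsScOrder (e 0) ∧ Embeds (e 0) (R (fun n => e (n + 1)))) :=
  .and (.isScOrder (k := k) h𝒮 (.var 0)) (.embeds (k := k) (.var 0) hR.wk)

theorem Term.rank {𝒮 : M} (h𝒮 : ∀ A, A ∈' 𝒮 ↔ StronglyCantorian A) {R : (ℕ → M) → M}
    (hR : Term τ (k + 3) R) : Term τ (k + 4) (fun e => rank (R e)) :=
  .sep (P := fun Z e => IsScOrder Z ∧ Embeds Z (R e)) (strat_rank h𝒮 hR)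

theorem mem_rank {𝒮 : M} (h𝒮 : ∀ A, A ∈' 𝒮 ↔ StronglyCantorian A) {R Z : M} :
    Z ∈' rank R ↔ IsScOrder Z ∧ Embeds Z R :=
  mem_sep (P := fun Z => IsScOrder Z ∧ Embeds Z R) 3 (strat_rank (k := 0) h𝒮 (.const R))

theorem rank_eq {R S : M} (h : Embeds R S) (h' : Embeds S R) : rank R = rank S := by
  unfold rank
  congr 1
  funext Z
  exact propext <| and_congr_right fun _ => ⟨fun H => H.trans h, fun H => H.trans h'⟩

theorem embeds_of_rank_eq {𝒮 : M} (h𝒮 : ∀ A, A ∈' 𝒮 ↔ StronglyCantorian A) {R S : M}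
    (hR : IsScOrder R) (h : rank R = rank S) : Embeds R S :=
  ((mem_rank h𝒮).1 (h ▸ (mem_rank h𝒮).2 ⟨hR, .refl R⟩)).2

theorem mem_rankOrder {𝒮 : M} (h𝒮 : ∀ A, A ∈' 𝒮 ↔ StronglyCantorian A) {z : M} :
    z ∈' rankOrder M ↔ ∃ R S, z = pair (rank R) (rank S) ∧
      IsScOrder R ∧ IsScOrder S ∧ (rank R = rank S ∨ EmbedsBelow R S) :=
  -- Relations on points of type 0 have type 3, their ranks 4, and pairs of ranks 6.
  mem_sep 6 <| .ex 3 <| .ex 3 <|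
    .and (.eq (.var 2) (.pair (.rank h𝒮 (k := 0) (.var 1)) (.rank h𝒮 (k := 0) (.var 0)))) <|
    .and (.isScOrder (k := 0) h𝒮 (.var 1)) <| .and (.isScOrder (k := 0) h𝒮 (.var 0)) <|
    .or (.eq (.rank h𝒮 (k := 0) (.var 1)) (.rank h𝒮 (k := 0) (.var 0)))
      (.embedsBelow (k := 0) (.var 1) (.var 0))

theorem dom_rankOrder {𝒮 : M} (h𝒮 : ∀ A, A ∈' 𝒮 ↔ StronglyCantorian A) {q : M} :
    Dom (rankOrder M) q ↔ ∃ R, IsScOrder R ∧ q = rank R := by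
  rw [Dom, mem_rankOrder h𝒮]
  constructor
  · rintro ⟨R, S, h, hR, -⟩
    exact ⟨R, hR, (pair_inj.1 h).1⟩
  · rintro ⟨R, hR, rfl⟩
    exact ⟨R, R, rfl, hR, hR, .inl rfl⟩

/-- Orders of equal rank embed in each other, so the choice of representatives does not matter;
`IsScOrder.not_embedsBelow` keeps the two ranks distinct. -/
theorem below_rankOrder {𝒮 : M} (h𝒮 : ∀ A, A ∈' 𝒮 ↔ StronglyCantorian A) {R S : M}
    (hR : IsScOrder R) (hS : IsScOrder S) :
    Below (rankOrder M) (rank R) (rank S) ↔ EmbedsBelow R S := by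
  constructor
  · rintro ⟨-, -, hne, h⟩
    obtain ⟨R', S', h, hR', hS', H⟩ := (mem_rankOrder h𝒮).1 h
    obtain ⟨h1, h2⟩ := pair_inj.1 h
    rcases H with H | H
    · exact absurd (h1.trans (H.trans h2.symm)) hne
    · exact ((embeds_of_rank_eq h𝒮 hR h1).trans_embedsBelow H).trans_embeds
        (embeds_of_rank_eq h𝒮 hS' h2.symm)
  · intro h
    refine ⟨(dom_rankOrder h𝒮).2 ⟨R, hR, rfl⟩, (dom_rankOrder h𝒮).2 ⟨S, hS, rfl⟩, fun H => ?_,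
      (mem_rankOrder h𝒮).2 ⟨R, S, rfl, hR, hS, .inr h⟩⟩
    exact hS.not_embedsBelow ((embeds_of_rank_eq h𝒮 hS H.symm).trans_embedsBelow h)

theorem scDom_rankOrder {𝒮 : M} (h𝒮 : ∀ A, A ∈' 𝒮 ↔ StronglyCantorian A) :
    ScDom (rankOrder M) := by
  have hA : ∀ q : M, q ∈' sep (Dom (rankOrder M)) ↔ Dom (rankOrder M) q := fun q =>
    mem_sep (P := Dom (rankOrder M)) 0 (.dom (.const _) (.var 0))
  -- With `R` of type 3, both `rank (lift R)` and `single (rank R)` have type 5, so this graph is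
  -- stratified; `rank (lift R) = rank R` makes it the singleton map.
  refine ⟨_, stronglyCantorian_of_graph 5
    (Q := fun a b => ∃ R, IsScOrder R ∧ a = rank (lift R) ∧ b = single (rank R))
    (fun τ => .ex 3 <| .and (.isScOrder (k := 0) h𝒮 (.var 0)) <|
      .and (.eq (.var 1) (.rank (k := 1) h𝒮 (.lift (k := 0) (.var 0)))) <|
      .eq (.var 2) (.single (.rank (k := 0) h𝒮 (.var 0)))) fun a b => ?_, hA⟩
  have key : ∀ R : M, IsScOrder R → rank (lift R) = rank R := fun R hR =>
    rank_eq (ScDom.lift_embeds hR.1) (ScDom.embeds_lift hR.1)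
  rw [hA, dom_rankOrder h𝒮]
  constructor
  · rintro ⟨R, hR, rfl, rfl⟩
    rw [key R hR]
    exact ⟨⟨R, hR, rfl⟩, rfl⟩
  · rintro ⟨⟨R, hR, rfl⟩, rfl⟩
    exact ⟨R, hR, (key R hR).symm, rfl⟩

theorem isScOrder_rankOrder {𝒮 : M} (h𝒮 : ∀ A, A ∈' 𝒮 ↔ StronglyCantorian A) :
    IsScOrder (rankOrder M) := by
  refine ⟨scDom_rankOrder h𝒮, fun a b c hab hbc => ?_, fun Y q hq hdom => ?_⟩
  · obtain ⟨R, hR, rfl⟩ := (dom_rankOrder h𝒮).1 hab.1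
    obtain ⟨S, hS, rfl⟩ := (dom_rankOrder h𝒮).1 hab.2.1
    obtain ⟨T, hT, rfl⟩ := (dom_rankOrder h𝒮).1 hbc.2.1
    rw [below_rankOrder h𝒮] at * <;> first | assumption | exact hab.trans hbc
  · obtain ⟨R, hR, rfl⟩ := (dom_rankOrder h𝒮).1 hdom
    -- These are the points of `R` that strictly bound an embedding into `R` of some order with rank
    -- in `Y`. An order realizing a minimal such bound has minimal rank in `Y`.
    have hZ : ∀ x, x ∈' sep (fun x => ∃ S, IsScOrder S ∧ rank S ∈' Y ∧
        ∃ f, IsMonotone f S R ∧ ∀ a b, pair a b ∈' f → Below R b x) ↔ ∃ S, IsScOrder S ∧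
          rank S ∈' Y ∧ ∃ f, IsMonotone f S R ∧ ∀ a b, pair a b ∈' f → Below R b x := fun x =>
      mem_sep 0 <| .ex 3 <| .and (.isScOrder (k := 0) h𝒮 (.var 0)) <|
        .and (.mem (.rank (k := 0) h𝒮 (.var 0)) (.const _)) <|
        .ex 3 <| .and (.isMonotone (k := 0) (.var 0) (.var 1) (.const _)) <|
        .all 0 <| .all 0 <| .imp (.mem (.pair (.var 1) (.var 0)) (.var 2))
          (.below (.const _) (.var 0) (.var 4))
    by_cases hmin : ∀ c, c ∈' Y → ¬ Below (rankOrder M) c (rank R)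
    · exact ⟨_, hq, hdom, hmin⟩
    push Not at hmin
    obtain ⟨c, hc, hcR⟩ := hmin
    obtain ⟨S, hS, rfl⟩ := (dom_rankOrder h𝒮).1 hcR.1
    rw [below_rankOrder h𝒮 hS hR] at hcR
    obtain ⟨f, x, hf, hx, hfx⟩ := hcR
    obtain ⟨x, hxZ, -, hmin⟩ := hR.2.2 _ x ((hZ x).2 ⟨S, hS, hc, f, hf, hfx⟩) hx
    obtain ⟨S, hS, hSY, f, hf, hfx⟩ := (hZ x).1 hxZ
    refine ⟨_, hSY, (dom_rankOrder h𝒮).2 ⟨S, hS, rfl⟩, fun c hc hcS => ?_⟩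
    obtain ⟨T, hT, rfl⟩ := (dom_rankOrder h𝒮).1 hcS.1
    rw [below_rankOrder h𝒮 hT hS] at hcS
    obtain ⟨g, b, y, hby, hg, hgy⟩ := hf.exists_comp_bounded hcS
    -- An order embedded below `S` is bounded by the image `y` of its bound in `S`, which lies below
    -- `x`.
    exact hmin y ((hZ y).2 ⟨T, hT, hc, g, hg, hgy⟩) (hfx _ _ hby)

/-- The embedding sends `a` to the rank of the segment below `a`, bounded by `rank R`. This raises
types by four, which four applications of `lift` compensate. -/
theorem IsScOrder.embedsBelow_rankOrder {𝒮 : M} (h𝒮 : ∀ A, A ∈' 𝒮 ↔ StronglyCantorian A) {R : M}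
    (hR : IsScOrder R) : EmbedsBelow R (rankOrder M) := by
  have h1 : ScDom R := hR.1
  have h4 : Embeds R (lift (lift (lift (lift R)))) :=
    ((h1.embeds_lift.trans h1.lift.embeds_lift).trans h1.lift.lift.embeds_lift).trans
      h1.lift.lift.lift.embeds_lift
  refine h4.trans_embedsBelow ?_
  obtain ⟨f, hf⟩ := exists_rel 4 (Q := fun x q => ∃ a, x = single (single (single (single a))) ∧
      Dom R a ∧ q = rank (NF.segment R a)) fun τ => .ex 0 <|
    .and (.eq (.var 1) (.single (.single (.single (.single (.var 0)))))) <|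
    .and (.dom (.const _) (.var 0)) <|
    .eq (.var 2) (.rank (k := 0) h𝒮 (.segment (.const _) (.var 0)))
  refine ⟨f, rank R, ⟨fun x hx => ?_, fun x q hxq => ?_, fun x q x' q' h h' H => ?_⟩,
    (dom_rankOrder h𝒮).2 ⟨R, hR, rfl⟩, fun x q hxq => ?_⟩
  · simp only [dom_lift] at hx
    obtain ⟨_, rfl, _, rfl, _, rfl, a, rfl, ha⟩ := hx
    exact ⟨_, (hf _ _).2 ⟨a, rfl, ha, rfl⟩⟩
  · obtain ⟨a, rfl, ha, rfl⟩ := (hf _ _).1 hxq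
    exact (dom_rankOrder h𝒮).2 ⟨_, hR.segment a, rfl⟩
  · obtain ⟨a, rfl, ha, rfl⟩ := (hf _ _).1 h
    obtain ⟨b, rfl, hb, rfl⟩ := (hf _ _).1 h'
    simp only [below_lift] at H
    exact (below_rankOrder h𝒮 (hR.segment a) (hR.segment b)).2 (hR.segment_embedsBelow_segment H)
  · obtain ⟨a, rfl, ha, rfl⟩ := (hf _ _).1 hxq
    exact (below_rankOrder h𝒮 (hR.segment a) hR).2 (segment_embedsBelow ha)

variable (M) in
/-- The strongly cantorian sets do not form a set. -/
theorem not_exists_set_of_stronglyCantorian :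
    ¬ ∃ 𝒮 : M, ∀ A, A ∈' 𝒮 ↔ StronglyCantorian A := by
  rintro ⟨𝒮, h𝒮⟩
  exact (isScOrder_rankOrder h𝒮).not_embedsBelow
    ((isScOrder_rankOrder h𝒮).embedsBelow_rankOrder h𝒮)

/-! ### Powerclasses in the category of sets -/

variable {A B C : NFCat M}

theorem const_isSet (A : NFCat M) {B : NFCat M} (b : El B) :
    ∃ G : M, IsGraph (fun _ : El A => b) G := by
  refine ⟨sep fun z => ∃ a, a ∈' A.set ∧ z = pair a b.1, fun p => ?_⟩
  rw [mem_sep 2 <| .ex 0 <| .and (.mem (.var 0) (.const _))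
    (.eq (.var 1) (.pair (.var 0) (.const _)))]
  exact ⟨fun ⟨a, ha, h⟩ => ⟨⟨a, ha⟩, h⟩, fun ⟨a, h⟩ => ⟨a.1, a.2, h⟩⟩

/-- The constant morphism with value `b`. -/
def constHom (A : NFCat M) {B : NFCat M} (b : El B) : A ⟶ B :=
  ⟨fun _ => b, const_isSet A b⟩

/-- The application of a morphism to an element. -/
def app (f : A ⟶ B) (a : El A) : El B := Hom.toFun f a

theorem hom_ext {f g : A ⟶ B} (h : ∀ a, app f a = app g a) : f = g :=
  Hom.ext (funext h)

variable (M) in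
/-- An object with exactly one element. -/
noncomputable def point : NFCat M := ⟨single (sep fun _ => False)⟩

/-- The element of `point M`. -/
noncomputable def star : El (point M) := ⟨_, (mem_single _ _).2 rfl⟩

theorem el_point (x : El (point M)) : x = star :=
  Subtype.ext ((mem_single _ _).1 x.2)

theorem mono_of_injective (f : A ⟶ B) (h : ∀ a a', app f a = app f a' → a = a') : Mono f :=
  ⟨fun _ _ H => hom_ext fun a => h _ _ (congrArg (fun k => app k a) H)⟩

theorem exists_pair_graph (f : A ⟶ B) :
    ∃ F : M, ∀ x y, pair x y ∈' F ↔ ∃ a : El A, a.1 = x ∧ (app f a).1 = y := by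
  obtain ⟨F, hF⟩ := f.isSet
  refine ⟨F, fun x y => (hF _).trans <| exists_congr fun a => ?_⟩
  rw [pair_inj]
  exact and_congr eq_comm eq_comm

/-- The product cone `C ⟵ C ⟶ 1` of an object and the one-element object. -/
noncomputable def prodPoint (C : NFCat M) : BinaryFan C (point M) :=
  BinaryFan.mk (𝟙 C) (constHom C star)

noncomputable def isLimitProdPoint (C : NFCat M) : IsLimit (prodPoint C) :=
  BinaryFan.isLimitMk (fun s => s.fst) (fun _ => Category.comp_id _)
    (fun _ => hom_ext fun _ => (el_point _).symm) fun _ m h _ =>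
    (Category.comp_id m).symm.trans h

/-- The inclusion of a subset. -/
def inclusion (h : ∀ x, x ∈' A.set → x ∈' B.set) : A ⟶ B :=
  ⟨fun x => ⟨x.1, h _ x.2⟩, id_isSet A⟩

variable (P : Powerclass (stronglyCantorianMaps M) C)

/-- A strongly cantorian subset of `C` is a small relation on `C × 1`, and its classifying map picks
out `p`. The pullback property at global points shows that the fibre over `p` is no larger than `A`.
-/
theorem exists_classifying_element (hA : StronglyCantorian A.set)
    (h : ∀ x, x ∈' A.set → x ∈' C.set) :
    ∃ p : El P.P, ∀ c, c ∈' A.set ↔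
      ∃ e : El P.E, (app (P.ε ≫ P.prod.fst) e).1 = c ∧ app (P.ε ≫ P.prod.snd) e = p := by
  have hsmall : IsSmallRelation (stronglyCantorianMaps M) (prodPoint C) (inclusion h) := by
    refine ⟨mono_of_injective _ fun a a' H => ?_, fun b => ?_⟩
    · have : (app (inclusion h) a).1 = (app (inclusion h) a').1 := congrArg Subtype.val H
      exact Subtype.ext this
    exact ⟨A.set, fun z => ⟨fun hz => ⟨⟨z, hz⟩, rfl, (el_point _).trans (el_point _).symm⟩,
      fun ⟨a, ha, _⟩ => ha ▸ a.2⟩, hA⟩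
  obtain ⟨ρ, ⟨k, hk⟩, -⟩ := P.classify _ _ (isLimitProdPoint C) _ _ hsmall
  have h1 : oneTimes (prodPoint C) P.isProd ρ ≫ P.prod.fst = 𝟙 C :=
    P.isProd.fac _ ⟨.left⟩
  have h2 : oneTimes (prodPoint C) P.isProd ρ ≫ P.prod.snd = constHom C star ≫ ρ :=
    P.isProd.fac _ ⟨.right⟩
  refine ⟨app ρ star, fun c => ⟨fun hc => ⟨app k ⟨c, hc⟩, ?_, ?_⟩, ?_⟩⟩
  · have := congrArg (fun g => app (g ≫ P.prod.fst) ⟨c, hc⟩) hk.w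
    simp only [Category.assoc, h1] at this
    exact congrArg Subtype.val this
  · have := congrArg (fun g => app (g ≫ P.prod.snd) ⟨c, hc⟩) hk.w
    simp only [Category.assoc, h2] at this
    exact this
  · rintro ⟨e, rfl, he⟩
    have hw : constHom (point M) e ≫ P.ε = constHom (point M) (app (P.ε ≫ P.prod.fst) e) ≫
        oneTimes (prodPoint C) P.isProd ρ := by
      refine BinaryFan.IsLimit.hom_ext P.isProd (hom_ext fun _ => ?_) (hom_ext fun _ => ?_)
      · exact (congrArg (fun g => app g (app (P.ε ≫ P.prod.fst) e)) h1).symm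
      · exact he.trans (congrArg (fun g => app g (app (P.ε ≫ P.prod.fst) e)) h2).symm
    have := congrArg (fun g => (app g star).1) (hk.lift_snd _ _ hw)
    exact this ▸ (app (hk.lift _ _ hw) star).2

/-- Smallness of `ε` concerns a subset of `E`; projecting it to `C` preserves strong cantorianness.
-/
theorem exists_fibre (p : El P.P) :
    ∃ A, StronglyCantorian A ∧ ∀ c, c ∈' A ↔
      ∃ e : El P.E, (app (P.ε ≫ P.prod.fst) e).1 = c ∧ app (P.ε ≫ P.prod.snd) e = p := by
  obtain ⟨F, hF, hFsc⟩ := P.small_ε.2 p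
  obtain ⟨G, hG⟩ := exists_pair_graph (P.ε ≫ P.prod.fst)
  have hA : ∀ c, c ∈' sep (fun c => ∃ x, x ∈' F ∧ pair x c ∈' G) ↔
      ∃ x, x ∈' F ∧ pair x c ∈' G := fun c =>
    mem_sep 0 <| .ex 0 <| .and (.mem (.var 0) (.const _)) (.mem (.pair (.var 0) (.var 1)) (.const _))
  refine ⟨_, hFsc.image hA fun x y y' h h' => ?_, fun c => ?_⟩
  · obtain ⟨a, rfl, rfl⟩ := (hG _ _).1 h
    obtain ⟨b, hb, rfl⟩ := (hG _ _).1 h'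
    rw [Subtype.ext hb]
  · rw [hA]
    constructor
    · rintro ⟨x, hx, hxc⟩
      obtain ⟨e, rfl, he⟩ := (hF _).1 hx
      obtain ⟨e', he', rfl⟩ := (hG _ _).1 hxc
      exact ⟨e', rfl, Subtype.ext he' ▸ he⟩
    · rintro ⟨e, rfl, he⟩
      exact ⟨e.1, (hF _).2 ⟨e, rfl, he⟩, (hG _ _).2 ⟨e, rfl, rfl⟩⟩

theorem exists_set_of_powerclass :
    ∃ 𝒮 : M, ∀ A, A ∈' 𝒮 ↔ ∃ p : El P.P, ∀ c, c ∈' A ↔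
      ∃ e : El P.E, (app (P.ε ≫ P.prod.fst) e).1 = c ∧ app (P.ε ≫ P.prod.snd) e = p := by
  obtain ⟨F, hF⟩ := exists_pair_graph (P.ε ≫ P.prod.fst)
  obtain ⟨G, hG⟩ := exists_pair_graph (P.ε ≫ P.prod.snd)
  refine ⟨sep fun A => ∃ p, p ∈' P.P.set ∧ ∀ c, c ∈' A ↔ ∃ e, pair e c ∈' F ∧ pair e p ∈' G,
    fun A => ?_⟩
  -- Both projections of `ε` are type-preserving graphs, so `e`, `c` and `p` share type 0 and `A`
  -- has type 1.
  rw [mem_sep 1 <| .ex 0 <| .and (.mem (.var 0) (.const _)) <| .all 0 <|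
    .iff (.mem (.var 0) (.var 2)) <| .ex 0 <| .and (.mem (.pair (.var 0) (.var 1)) (.const _))
    (.mem (.pair (.var 0) (.var 2)) (.const _))]
  have key : ∀ (p : El P.P) c, (∃ e, pair e c ∈' F ∧ pair e p.1 ∈' G) ↔
      ∃ e : El P.E, (app (P.ε ≫ P.prod.fst) e).1 = c ∧ app (P.ε ≫ P.prod.snd) e = p := by
    intro p c
    simp only [hF, hG]
    constructor
    · rintro ⟨_, ⟨e, rfl, rfl⟩, e', he', hp⟩
      exact ⟨e, rfl, Subtype.ext (Subtype.ext he' ▸ hp)⟩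
    · rintro ⟨e, rfl, rfl⟩
      exact ⟨_, ⟨e, rfl, rfl⟩, e, rfl, rfl⟩
  constructor
  · rintro ⟨p, hp, h⟩
    exact ⟨⟨p, hp⟩, fun c => (h c).trans (key ⟨p, hp⟩ c)⟩
  · rintro ⟨p, h⟩
    exact ⟨p.1, p.2, fun c => (h c).trans (key p c).symm⟩

variable (M) in
/-- The universal set has no powerclass. -/
theorem exists_isEmpty_powerclass :
    ∃ V : NFCat M, IsEmpty (Powerclass (stronglyCantorianMaps M) V) := by
  have hV : ∀ x : M, x ∈' sep (fun x => x = x) ↔ x = x := fun x =>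
    mem_sep (P := fun x => x = x) 0 (.eq (.var 0) (.var 0))
  refine ⟨⟨sep fun x => x = x⟩, ⟨fun P => not_exists_set_of_stronglyCantorian M ?_⟩⟩
  obtain ⟨𝒮, h𝒮⟩ := exists_set_of_powerclass P
  refine ⟨𝒮, fun A => (h𝒮 A).trans ⟨?_, fun hA => ?_⟩⟩
  · rintro ⟨p, hp⟩
    obtain ⟨B, hB, hBp⟩ := exists_fibre P p
    exact hB.subset fun x hx => (hBp x).2 ((hp x).1 hx)
  · exact exists_classifying_element (A := ⟨A⟩) P hA fun x _ => (hV x).2 rfl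

end NF

theorem mainTheorem10 {M : Type u} [NFModel M] (hSCU : NF.SCU M) :
    ¬ ∀ C : NF.NFCat M, Nonempty (Powerclass (NF.stronglyCantorianMaps M) C) := by
  obtain ⟨V, hV⟩ := NF.exists_isEmpty_powerclass M
  exact fun h => (h V).elim hV.false
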